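/- Let $b(n)$ ($n\ge 0$) be the coefficients of the second order mock theta function $$\mathcal{B}(q)=\sum_{m\ge 0}\frac{q^m(-q;q^2)_m}{(q;q^2)_{m+1}}=\sum_{n\ge 0}b(n)q^n,\qquad (a;t)_m:=\prod_{j=0}^{m-1}(1-at^j).$$ Let $p\ge 5$ be a prime and let $\ell$ be an integer with $1\le \ell\le p-1$ such that the Legendre symbol satisfies $\left(\frac{12\ell+9}{p}\right)=-1$. Then for all integers $n\ge 0$ and $k\ge 0$, $$b\left(6p^{2k+3}n+\frac{3p^{2k+2}(4\ell+3)-1}{2}\right)\equiv 0 \pmod{36}.$$ -/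

import Mathlib

open PowerSeries

/-- The `q`-Pochhammer symbol `(a; t)_n = ∏_{j=0}^{n-1} (1 - a t^j)` in `ℤ⟦q⟧`. -/
noncomputable def qPoch (a t : PowerSeries ℤ) (n : ℕ) : PowerSeries ℤ :=
  ∏ j ∈ Finset.range n, (1 - a * t ^ j)

/-- The `m`-th summand `q^m (-q; q^2)_m / (q; q^2)_{m+1}` of the second order mock theta
function `B(q)`. The denominator has constant coefficient `1`, so `invOfUnit _ 1` is its
inverse in `ℤ⟦q⟧` (see `mockBTerm_mul`). -/
noncomputable def mockBTerm (m : ℕ) : PowerSeries ℤ :=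
  X ^ m * qPoch (-X) (X ^ 2) m * invOfUnit (qPoch X (X ^ 2) (m + 1)) 1

/-- The coefficient `b(n)` of `q^n` in `B(q) = ∑_{m ≥ 0} q^m (-q; q^2)_m / (q; q^2)_{m+1}`.
The `m`-th summand is divisible by `q^m`, so only the summands with `m ≤ n` contribute. -/
noncomputable def mockBCoeff (n : ℕ) : ℤ :=
  coeff n (∑ m ∈ Finset.range (n + 1), mockBTerm m)

/-- The second order mock theta function `B(q) = ∑_{n ≥ 0} b(n) q^n`, as a power series. -/
noncomputable def mockB : PowerSeries ℤ :=
  PowerSeries.mk mockBCoeff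

/-- The summands are the quotients they are meant to be. -/
theorem mockBTerm_mul (m : ℕ) :
    mockBTerm m * qPoch X (X ^ 2) (m + 1) = X ^ m * qPoch (-X) (X ^ 2) m := by
  have h : constantCoeff (qPoch X (X ^ 2) (m + 1)) = ((1 : ℤˣ) : ℤ) := by
    simp [qPoch, map_prod]
  rw [mockBTerm, mul_assoc, invOfUnit_mul _ _ h, mul_one]

theorem coeff_mockBTerm_of_lt {n m : ℕ} (h : n < m) : coeff n (mockBTerm m) = 0 := by
  rw [mockBTerm, mul_assoc, coeff_X_pow_mul', if_neg (not_le.mpr h)]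

open scoped PowerSeries.WithPiTopology in
/-- `mockB` is the sum of the defining series, coefficientwise. -/
theorem hasSum_mockB : HasSum mockBTerm mockB := by
  rw [PowerSeries.WithPiTopology.hasSum_iff_hasSum_coeff]
  intro n
  have h : coeff n mockB = ∑ m ∈ Finset.range (n + 1), coeff n (mockBTerm m) := by
    simp [mockB, mockBCoeff]
  rw [h]
  apply hasSum_sum_of_ne_finset_zero
  intro m hm
  apply coeff_mockBTerm_of_lt
  simpa using hm

/-!
Everything rests on a closed form for the even part `G(q) = ∑ b(2n) q^n`.

Extended to negative `m`, the summand of `B(q)` becomes the summand of `B(-q)`, so `B(q) + B(-q)`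
is a bilateral series, the case `z = q`, `a = -q`, `b = q³` (base `q²`) of Ramanujan's `₁ψ₁` sum,
up to the factor `1 - q`. Following Andrews and Askey, it is summed by the contiguous relation
that moves `b` to `b q²` (`psiSum_contiguous`): iterating it from `b = q³` and from `b = q²` leads
to the same limit at `b = 0` (`psiSum_one_mul`), and at `b = q²` the series is one-sided and is
summed by the `q`-binomial theorem (`psiSum_zero_mul`). The result is `mockBEven_mul`, in classical
notation `G(q) = (q²; q²)_∞⁵ / (q; q)_∞⁴`.

Gauss's product formulas for `φ(-q) = ∑ (-1)^s q^(s²)` and `ψ(q) = ∑ q^(s(s+1)/2)`, obtained from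
the finite forms of Shanks, turn this into `G(q) φ(-q) = ψ(q)²` and
`G(q) φ(-q)² = φ(-q²)² ψ(q²)`.

* Modulo `4`: `φ(-q)² ≡ 1`, so `G(q) ≡ ψ(q²)`. Hence `4 ∣ b(2j)` unless `4j + 1` is a square.
* Modulo `9`: `ψ(q) = φ(-q) (-q; q)_∞³` and `(-q; q)_∞³` is modulo `3` a series `K` in `q³`, so
  `ψ = φ K + 3 r`, where `r`, like `φ` and `ψ`, has no exponents that are `2` modulo `3`. Then
  `G = ψ² / φ ≡ φ K² + 6 K r` has no such exponents modulo `9`. Hence `9 ∣ b(2j)` for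
  `j ≡ 2` modulo `3`.

So `36 ∣ b(N)` if `N ≡ 4` modulo `6` and `2N + 1` is not a square. For the given index,
`2N + 1 = p^(2k+2) (12pn + 12ℓ + 9)`, and `12ℓ + 9` is not a square modulo `p`.
-/

open scoped PowerSeries.WithPiTopology
open Filter Topology

/-! ### Convergence of power series and infinite `q`-products -/

theorem tendsto_order_of_X_pow_dvd {f : ℕ → ℤ⟦X⟧} (h : ∀ n, X ^ n ∣ f n) :
    Tendsto (fun n ↦ (f n).order) atTop (𝓝 ⊤) := by
  refine ENat.tendsto_nhds_top_iff_natCast_lt.mpr fun n ↦ ?_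
  filter_upwards [eventually_gt_atTop n] with m hm
  exact lt_of_lt_of_le (Nat.cast_lt.mpr hm)
    (le_order _ _ fun i hi ↦ X_pow_dvd_iff.mp (h m) i (Nat.cast_lt.mp hi))

theorem summable_of_X_pow_dvd {f : ℕ → ℤ⟦X⟧} (h : ∀ n, X ^ n ∣ f n) : Summable f :=
  WithPiTopology.summable_of_tendsto_order_atTop_nhds_top _ (tendsto_order_of_X_pow_dvd h)

theorem X_pow_dvd_tsum {f : ℕ → ℤ⟦X⟧} (hf : Summable f) {m : ℕ} (h : ∀ n, X ^ m ∣ f n) :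
    X ^ m ∣ ∑' n, f n := by
  rw [X_pow_dvd_iff]
  intro d hd
  have := (WithPiTopology.hasSum_iff_hasSum_coeff ℤ).mp hf.hasSum d
  refine this.unique ?_
  simp only [fun n ↦ X_pow_dvd_iff.mp (h n) d hd]
  exact hasSum_zero

theorem tendsto_of_X_pow_dvd {f : ℕ → ℤ⟦X⟧} {g : ℤ⟦X⟧} (h : ∀ n, X ^ n ∣ f n - g) :
    Tendsto f atTop (𝓝 g) := by
  rw [WithPiTopology.tendsto_iff_coeff_tendsto]
  intro d
  refine tendsto_const_nhds.congr' ?_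
  filter_upwards [eventually_gt_atTop d] with n hn
  have := X_pow_dvd_iff.mp (h n) d hn
  rw [map_sub] at this
  linarith

/-- The infinite `q`-Pochhammer symbol `(a; t)_∞ = ∏_{j ≥ 0} (1 - a t^j)`; it converges as soon as
`X ∣ t`. -/
noncomputable def qPochInf (a t : ℤ⟦X⟧) : ℤ⟦X⟧ :=
  ∏' j : ℕ, (1 - a * t ^ j)

theorem multipliable_qPoch (a : ℤ⟦X⟧) {t : ℤ⟦X⟧} (ht : X ∣ t) :
    Multipliable fun j : ℕ ↦ 1 - a * t ^ j := by
  simp_rw [sub_eq_add_neg]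
  refine WithPiTopology.multipliable_one_add_of_tendsto_order_atTop_nhds_top _
    (tendsto_order_of_X_pow_dvd fun n ↦ ?_)
  exact ((pow_dvd_pow_of_dvd ht n).mul_left a).neg_right

theorem tendsto_qPoch (a : ℤ⟦X⟧) {t : ℤ⟦X⟧} (ht : X ∣ t) :
    Tendsto (qPoch a t) atTop (𝓝 (qPochInf a t)) :=
  (multipliable_qPoch a ht).hasProd.tendsto_prod_nat

theorem qPoch_zero (a t : ℤ⟦X⟧) : qPoch a t 0 = 1 := by simp [qPoch]

theorem qPoch_succ (a t : ℤ⟦X⟧) (n : ℕ) :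
    qPoch a t (n + 1) = qPoch a t n * (1 - a * t ^ n) := by
  simp [qPoch, Finset.prod_range_succ]

theorem qPoch_succ' (a t : ℤ⟦X⟧) (n : ℕ) :
    qPoch a t (n + 1) = (1 - a) * qPoch (a * t) t n := by
  simp only [qPoch, Finset.prod_range_succ', pow_zero, mul_one]
  rw [mul_comm]
  congr 1
  exact Finset.prod_congr rfl fun j _ ↦ by ring

theorem map_qPoch (σ : ℤ⟦X⟧ →+* ℤ⟦X⟧) (a t : ℤ⟦X⟧) (n : ℕ) :
    σ (qPoch a t n) = qPoch (σ a) (σ t) n := by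
  simp [qPoch]

theorem constantCoeff_qPoch {a : ℤ⟦X⟧} (ha : constantCoeff a = 0) (t : ℤ⟦X⟧) (n : ℕ) :
    constantCoeff (qPoch a t n) = 1 := by
  simp [qPoch, ha]

theorem qPochInf_eq_mul (a : ℤ⟦X⟧) {t : ℤ⟦X⟧} (ht : X ∣ t) :
    qPochInf a t = (1 - a) * qPochInf (a * t) t := by
  refine tendsto_nhds_unique ((tendsto_qPoch a ht).comp (tendsto_add_atTop_nat 1)) ?_
  refine ((tendsto_qPoch (a * t) ht).const_mul (1 - a)).congr fun n ↦ ?_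
  exact (qPoch_succ' a t n).symm

theorem constantCoeff_qPochInf {a t : ℤ⟦X⟧} (ha : constantCoeff a = 0) (ht : X ∣ t) :
    constantCoeff (qPochInf a t) = 1 := by
  have h := ((WithPiTopology.continuous_constantCoeff ℤ).tendsto _).comp (tendsto_qPoch a ht)
  refine tendsto_nhds_unique h (tendsto_const_nhds.congr fun n ↦ ?_)
  simp [constantCoeff_qPoch ha]

theorem qPochInf_ne_zero {a t : ℤ⟦X⟧} (ha : constantCoeff a = 0) (ht : X ∣ t) :
    qPochInf a t ≠ 0 := fun h ↦ by
  have := constantCoeff_qPochInf ha ht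
  simp [h] at this

theorem qPochInf_mul_neg (a : ℤ⟦X⟧) {t : ℤ⟦X⟧} (ht : X ∣ t) :
    qPochInf a t * qPochInf (-a) t = qPochInf (a ^ 2) (t ^ 2) := by
  rw [qPochInf, qPochInf, qPochInf,
    ← (multipliable_qPoch a ht).tprod_mul (multipliable_qPoch (-a) ht)]
  exact tprod_congr fun j ↦ by ring

theorem qPochInf_even_mul_odd (a : ℤ⟦X⟧) {t : ℤ⟦X⟧} (ht : X ∣ t) :
    qPochInf a t = qPochInf a (t ^ 2) * qPochInf (a * t) (t ^ 2) := by
  have ht2 : X ∣ t ^ 2 := ht.trans (dvd_pow_self t two_ne_zero)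
  refine tendsto_nhds_unique
    ((tendsto_qPoch a ht).comp (tendsto_id.const_mul_atTop' (two_pos : 0 < 2))) ?_
  refine ((tendsto_qPoch a ht2).mul (tendsto_qPoch (a * t) ht2)).congr fun n ↦ ?_
  induction n with
  | zero => simp [qPoch]
  | succ n ih =>
    simp only [Function.comp, id] at ih ⊢
    rw [show 2 * (n + 1) = 2 * n + 1 + 1 by ring]
    rw [qPoch_succ, qPoch_succ, qPoch_succ _ _ (2 * n + 1), qPoch_succ _ _ (2 * n), ← ih]
    ring

theorem continuous_expand {p : ℕ} (hp : p ≠ 0) :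
    Continuous (expand p hp : ℤ⟦X⟧ → ℤ⟦X⟧) := by
  rw [continuous_iff_continuousAt]
  intro f
  rw [ContinuousAt, WithPiTopology.tendsto_iff_coeff_tendsto]
  intro d
  simp only [coeff_expand]
  split_ifs
  · exact (WithPiTopology.continuous_coeff ℤ _).tendsto f
  · exact tendsto_const_nhds

theorem expand_qPochInf {p : ℕ} (hp : p ≠ 0) (a : ℤ⟦X⟧) {t : ℤ⟦X⟧} (ht : X ∣ t) :
    expand p hp (qPochInf a t) = qPochInf (expand p hp a) (expand p hp t) := by
  rw [qPochInf, (multipliable_qPoch a ht).map_tprod (expand p hp) (continuous_expand hp)]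
  simp [qPochInf]

/-- Euler's identity: `(q; q²)_∞` and `(-q; q)_∞` are inverse to each other. -/
theorem qPochInf_odd_mul_distinct :
    qPochInf X (X ^ 2) * qPochInf (-X) X = (1 : ℤ⟦X⟧) := by
  have h1 := qPochInf_mul_neg (X : ℤ⟦X⟧) dvd_rfl
  have h2 := qPochInf_even_mul_odd (X : ℤ⟦X⟧) dvd_rfl
  rw [← pow_two, ← h1] at h2
  refine mul_left_cancel₀ (qPochInf_ne_zero (a := X) (t := X) (by simp) dvd_rfl) ?_
  linear_combination -h2

/-! ### The bilateral series -/

/-- The `n`-th term, `n ≥ 0`, of the bilateral series `∑ z^n (a; q²)_n / (b; q²)_n` at `z = q`,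
`a = -q`, `b = q^(m+2)`. -/
noncomputable def psiPosTerm (m n : ℕ) : ℤ⟦X⟧ :=
  X ^ n * qPoch (-X) (X ^ 2) n * invOfUnit (qPoch (X ^ (m + 2)) (X ^ 2) n) 1

/-- The term of index `-k` of the bilateral series `∑ z^n (a; q²)_n / (b; q²)_n` at `z = q`,
`a = -q`, `b = q^(m+2)`, in the form `∏_{j < k} (q^{2j} - q^m) / (1 + q^{2j+1})`. -/
noncomputable def psiNegTerm (m k : ℕ) : ℤ⟦X⟧ :=
  ∏ j ∈ Finset.range k, (X ^ (2 * j) - X ^ m) * invOfUnit (1 + X ^ (2 * j + 1)) 1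

theorem psiPosTerm_mul (m n : ℕ) :
    psiPosTerm m n * qPoch (X ^ (m + 2)) (X ^ 2) n = X ^ n * qPoch (-X) (X ^ 2) n := by
  rw [psiPosTerm, mul_assoc, invOfUnit_mul _ _ (by simp [constantCoeff_qPoch]), mul_one]

theorem qPoch_ne_zero {a : ℤ⟦X⟧} (ha : constantCoeff a = 0) (t : ℤ⟦X⟧) (n : ℕ) :
    qPoch a t n ≠ 0 := fun h ↦ by
  have := constantCoeff_qPoch ha t n
  simp [h] at this

theorem psiPosTerm_zero (m : ℕ) : psiPosTerm m 0 = 1 := by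
  simpa [qPoch_zero] using psiPosTerm_mul m 0

theorem psiPosTerm_succ (m n : ℕ) :
    psiPosTerm m (n + 1) * (1 - X ^ (m + 2 + 2 * n)) =
      X * (1 + X ^ (2 * n + 1)) * psiPosTerm m n := by
  have h1 := psiPosTerm_mul m n
  have h2 := psiPosTerm_mul m (n + 1)
  rw [qPoch_succ, qPoch_succ] at h2
  refine mul_right_cancel₀ (qPoch_ne_zero (a := X ^ (m + 2)) (by simp) (X ^ 2) n) ?_
  linear_combination h2 - X * (1 + X ^ (2 * n + 1)) * h1

theorem psiPosTerm_shift (m n : ℕ) :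
    (1 - X ^ (m + 2)) * psiPosTerm m n =
      (1 - X ^ (m + 2 + 2 * n)) * psiPosTerm (m + 2) n := by
  have h1 := psiPosTerm_mul m n
  have h2 := psiPosTerm_mul (m + 2) n
  have h3 := qPoch_succ (X ^ (m + 2)) (X ^ 2 : ℤ⟦X⟧) n
  rw [qPoch_succ', ← pow_add] at h3
  refine mul_right_cancel₀ (qPoch_ne_zero (a := X ^ (m + 2)) (by simp) (X ^ 2) n) ?_
  linear_combination (1 - X ^ (m + 2)) * h1 - (1 - X ^ (m + 2)) * h2 + psiPosTerm (m + 2) n * h3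

theorem psiNegTerm_zero (m : ℕ) : psiNegTerm m 0 = 1 := by simp [psiNegTerm]

theorem psiNegTerm_succ (m k : ℕ) :
    psiNegTerm m (k + 1) * (1 + X ^ (2 * k + 1)) = (X ^ (2 * k) - X ^ m) * psiNegTerm m k := by
  have h : invOfUnit (1 + X ^ (2 * k + 1) : ℤ⟦X⟧) 1 * (1 + X ^ (2 * k + 1)) = 1 :=
    invOfUnit_mul _ _ (by simp)
  rw [psiNegTerm, Finset.prod_range_succ, ← psiNegTerm]
  linear_combination psiNegTerm m k * (X ^ (2 * k) - X ^ m) * h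

theorem one_add_X_pow_ne_zero (k : ℕ) : (1 + X ^ (k + 1) : ℤ⟦X⟧) ≠ 0 := fun h ↦ by
  simpa using congrArg constantCoeff h

theorem psiNegTerm_shift (m k : ℕ) :
    psiNegTerm (m + 2) (k + 1) * (1 + X ^ (2 * k + 1)) =
      X ^ (2 * k) * (1 - X ^ (m + 2)) * psiNegTerm m k := by
  induction k with
  | zero => simpa [psiNegTerm_zero] using psiNegTerm_succ (m + 2) 0
  | succ k ih =>
    rw [psiNegTerm_succ]
    refine mul_right_cancel₀ (one_add_X_pow_ne_zero (2 * k)) ?_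
    linear_combination (X ^ (2 * (k + 1)) - X ^ (m + 2)) * ih -
      X ^ (2 * (k + 1)) * (1 - X ^ (m + 2)) * psiNegTerm_succ m k

theorem psiNegTerm_contiguous (m k : ℕ) :
    (1 - X ^ (m + 2)) * psiNegTerm m (k + 1) + X ^ m * (1 - X ^ (m + 2)) * psiNegTerm m k =
      (1 + X ^ (m + 1)) * psiNegTerm (m + 2) (k + 1) := by
  refine mul_right_cancel₀ (one_add_X_pow_ne_zero (2 * k)) ?_
  linear_combination (1 - X ^ (m + 2)) * psiNegTerm_succ m k -
    (1 + X ^ (m + 1)) * psiNegTerm_shift m k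

theorem X_pow_dvd_psiPosTerm (m n : ℕ) : X ^ n ∣ psiPosTerm m n := by
  rw [psiPosTerm, mul_assoc]
  exact dvd_mul_right _ _

theorem X_pow_dvd_psiNegTerm_succ (m k : ℕ) : X ^ k ∣ psiNegTerm m (k + 1) := by
  rcases m.eq_zero_or_pos with rfl | hm
  · simp [psiNegTerm, Finset.prod_range_succ']
  · rw [psiNegTerm, Finset.prod_range_succ']
    refine Dvd.dvd.mul_right ?_ _
    have : (X ^ k : ℤ⟦X⟧) = ∏ _j ∈ Finset.range k, X := by simp
    rw [this]
    refine Finset.prod_dvd_prod_of_dvd _ _ fun j _ ↦ Dvd.dvd.mul_right ?_ _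
    exact dvd_sub (dvd_pow_self X (by omega)) (dvd_pow_self X (by omega))

theorem summable_psiPosTerm (m : ℕ) : Summable (psiPosTerm m) :=
  summable_of_X_pow_dvd (X_pow_dvd_psiPosTerm m)

theorem summable_psiNegTerm_succ (m : ℕ) : Summable fun k ↦ psiNegTerm m (k + 1) :=
  summable_of_X_pow_dvd (X_pow_dvd_psiNegTerm_succ m)

/-- The bilateral series `∑_{n ∈ ℤ} q^n (-q; q²)_n / (q^(m+2); q²)_n`. -/
noncomputable def psiSum (m : ℕ) : ℤ⟦X⟧ :=
  ∑' n, psiPosTerm m n + ∑' k, psiNegTerm m (k + 1)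

theorem psiPos_contiguous (m : ℕ) :
    (1 + X ^ m) * (1 - X ^ (m + 2)) * ∑' n, psiPosTerm m n =
      (1 + X ^ (m + 1)) * ∑' n, psiPosTerm (m + 2) n + X ^ m * (1 - X ^ (m + 2)) := by
  have s0 := summable_psiPosTerm m
  have s1 := (summable_nat_add_iff 1).mpr s0
  have h1 := s0.tsum_eq_zero_add
  -- telescoping of `X ^ m * (1 - X ^ (m + 2)) * psiPosTerm m n`
  have key : ∀ n, (1 + X ^ m) * (1 - X ^ (m + 2)) * psiPosTerm m n -
      (1 + X ^ (m + 1)) * psiPosTerm (m + 2) n =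
      X ^ m * (1 - X ^ (m + 2)) * psiPosTerm m n -
        X ^ m * (1 - X ^ (m + 2)) * psiPosTerm m (n + 1) := fun n ↦ by
    have e1 := psiPosTerm_shift m n
    have e2 := psiPosTerm_shift m (n + 1)
    have e3 := psiPosTerm_succ (m + 2) n
    linear_combination e1 + X ^ m * e2 + X ^ m * e3
  have := congrArg tsum (funext key)
  rw [((s0.mul_left _)).tsum_sub ((summable_psiPosTerm (m + 2)).mul_left _),
    (s0.mul_left _).tsum_sub (s1.mul_left _), s0.tsum_mul_left, s0.tsum_mul_left,
    s1.tsum_mul_left, (summable_psiPosTerm (m + 2)).tsum_mul_left] at this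
  rw [psiPosTerm_zero] at h1
  linear_combination this + X ^ m * (1 - X ^ (m + 2)) * h1

theorem psiNeg_contiguous (m : ℕ) :
    (1 + X ^ m) * (1 - X ^ (m + 2)) * ∑' k, psiNegTerm m (k + 1) + X ^ m * (1 - X ^ (m + 2)) =
      (1 + X ^ (m + 1)) * ∑' k, psiNegTerm (m + 2) (k + 1) := by
  have s1 := summable_psiNegTerm_succ m
  have s0 := (summable_nat_add_iff 1).mp s1
  have h1 := s0.tsum_eq_zero_add
  have := congrArg tsum (funext (psiNegTerm_contiguous m))
  rw [(s1.mul_left _).tsum_add (s0.mul_left _), s0.tsum_mul_left, s1.tsum_mul_left,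
    (summable_psiNegTerm_succ (m + 2)).tsum_mul_left] at this
  rw [psiNegTerm_zero] at h1
  linear_combination this - X ^ m * (1 - X ^ (m + 2)) * h1

/-- The contiguous relation of Andrews and Askey, which moves `b = q^(m+2)` to `b q²`. -/
theorem psiSum_contiguous (m : ℕ) :
    (1 + X ^ m) * (1 - X ^ (m + 2)) * psiSum m = (1 + X ^ (m + 1)) * psiSum (m + 2) := by
  rw [psiSum, psiSum]
  linear_combination psiPos_contiguous m + psiNeg_contiguous m

/-- The contiguous relation, applied `K` times. -/
theorem psiSum_iterate (m K : ℕ) :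
    qPoch (-X ^ m) (X ^ 2) K * qPoch (X ^ (m + 2)) (X ^ 2) K * psiSum m =
      qPoch (-X ^ (m + 1)) (X ^ 2) K * psiSum (m + 2 * K) := by
  induction K with
  | zero => simp [qPoch_zero]
  | succ K ih =>
    have := psiSum_contiguous (m + 2 * K)
    simp only [qPoch_succ]
    rw [show m + 2 * (K + 1) = m + 2 * K + 2 by ring]
    linear_combination (1 + X ^ (m + 2 * K)) * (1 - X ^ (m + 2 * K + 2)) * ih +
      qPoch (-X ^ (m + 1)) (X ^ 2) K * this

theorem X_pow_dvd_qPoch_sub_one {m : ℕ} {a : ℤ⟦X⟧} (ha : X ^ m ∣ a) (t : ℤ⟦X⟧) (n : ℕ) :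
    X ^ m ∣ qPoch a t n - 1 := by
  induction n with
  | zero => simp [qPoch_zero]
  | succ n ih =>
    rw [qPoch_succ, show qPoch a t n * (1 - a * t ^ n) - 1 =
      (qPoch a t n - 1) - a * (t ^ n * qPoch a t n) by ring]
    exact dvd_sub ih (ha.mul_right _)

theorem X_pow_dvd_psiPosTerm_sub (m n : ℕ) :
    X ^ m ∣ psiPosTerm m n - X ^ n * qPoch (-X) (X ^ 2) n := by
  have h := psiPosTerm_mul m n
  rw [← h, show psiPosTerm m n - psiPosTerm m n * qPoch (X ^ (m + 2)) (X ^ 2) n =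
    -psiPosTerm m n * (qPoch (X ^ (m + 2)) (X ^ 2) n - 1) by ring]
  exact (X_pow_dvd_qPoch_sub_one (pow_dvd_pow X (by omega)) _ _).mul_left _

theorem X_pow_dvd_psiNegTerm_sub (m k : ℕ) :
    X ^ m ∣ psiNegTerm (m + 1) k - psiNegTerm m k := by
  induction k with
  | zero => simp [psiNegTerm_zero]
  | succ k ih =>
    rw [psiNegTerm, psiNegTerm, Finset.prod_range_succ, Finset.prod_range_succ, ← psiNegTerm,
      ← psiNegTerm]
    obtain ⟨c, hc⟩ := ih
    refine ⟨invOfUnit (1 + X ^ (2 * k + 1)) 1 *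
      (c * (X ^ (2 * k) - X ^ (m + 1)) + psiNegTerm m k * (1 - X)), ?_⟩
    linear_combination invOfUnit (1 + X ^ (2 * k + 1)) 1 * (X ^ (2 * k) - X ^ (m + 1)) * hc

theorem X_pow_dvd_psiSum_sub (m : ℕ) : X ^ m ∣ psiSum (m + 1) - psiSum m := by
  have s1 := summable_psiPosTerm m
  have s2 := summable_psiPosTerm (m + 1)
  have s3 := summable_psiNegTerm_succ m
  have s4 := summable_psiNegTerm_succ (m + 1)
  rw [psiSum, psiSum, add_sub_add_comm, ← s2.tsum_sub s1, ← s4.tsum_sub s3]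
  refine dvd_add (X_pow_dvd_tsum (s2.sub s1) fun n ↦ ?_)
    (X_pow_dvd_tsum (s4.sub s3) fun k ↦ X_pow_dvd_psiNegTerm_sub m (k + 1))
  have h1 := X_pow_dvd_psiPosTerm_sub m n
  have h2 := (pow_dvd_pow X (Nat.le_succ m)).trans (X_pow_dvd_psiPosTerm_sub (m + 1) n)
  simpa using dvd_sub h2 h1

/-- Iterating the contiguous relation from `b = q³` and from `b = q²` leads to the same limit
`b → 0`, which eliminates that limit. -/
theorem psiSum_one_mul :
    qPochInf (-X) (X ^ 2) * qPochInf (X ^ 3) (X ^ 2) * qPochInf (-X) (X ^ 2) * psiSum 1 =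
      qPochInf (-X ^ 2) (X ^ 2) * qPochInf (-1) (X ^ 2) * qPochInf (X ^ 2) (X ^ 2) * psiSum 0 := by
  have hX : (X : ℤ⟦X⟧) ∣ X ^ 2 := dvd_pow_self X two_ne_zero
  have t (a : ℤ⟦X⟧) := tendsto_qPoch a hX
  have hL := (((t (-X)).mul (t (X ^ 3))).mul (t (-X))).mul_const (psiSum 1)
  have hR := (((t (-X ^ 2)).mul (t (-1))).mul (t (X ^ 2))).mul_const (psiSum 0)
  have h0 : Tendsto (fun K ↦ psiSum (2 * K + 1) - psiSum (2 * K)) atTop (𝓝 0) := by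
    refine tendsto_of_X_pow_dvd fun K ↦ ?_
    rw [sub_zero]
    exact (pow_dvd_pow X (by omega)).trans (X_pow_dvd_psiSum_sub (2 * K))
  refine sub_eq_zero.mp (tendsto_nhds_unique (hL.sub hR) ?_)
  have := ((t (-X ^ 2)).mul (t (-X))).mul h0
  rw [mul_zero] at this
  refine this.congr fun K ↦ ?_
  have e1 := psiSum_iterate 1 K
  have e0 := psiSum_iterate 0 K
  norm_num at e1 e0
  rw [add_comm 1 (2 * K)] at e1
  linear_combination qPoch (-X ^ 2) (X ^ 2) K * e0 - qPoch (-X) (X ^ 2) K * e1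

/-- The `n`-th term of the `q`-binomial series `∑ z^n (-q; q²)_n / (q²; q²)_n` at
`z = q^(2N+1)`. -/
noncomputable def qBinomTerm (N n : ℕ) : ℤ⟦X⟧ := X ^ (2 * N * n) * psiPosTerm 0 n

theorem summable_qBinomTerm (N : ℕ) : Summable (qBinomTerm N) :=
  summable_of_X_pow_dvd fun n ↦ (X_pow_dvd_psiPosTerm 0 n).mul_left _

theorem tsum_qBinomTerm_succ (N : ℕ) :
    (1 - X ^ (2 * N + 1)) * ∑' n, qBinomTerm N n =
      (1 + X ^ (2 * N + 2)) * ∑' n, qBinomTerm (N + 1) n := by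
  have s0 := summable_qBinomTerm N
  have s1 := summable_qBinomTerm (N + 1)
  have s0' := (summable_nat_add_iff 1).mpr s0
  have s1' := (summable_nat_add_iff 1).mpr s1
  have h0 := s0.tsum_eq_zero_add
  have h1 := s1.tsum_eq_zero_add
  have key : ∀ n, qBinomTerm N (n + 1) - qBinomTerm (N + 1) (n + 1) =
      X ^ (2 * N + 1) * qBinomTerm N n + X ^ (2 * N + 2) * qBinomTerm (N + 1) n := fun n ↦ by
    have := psiPosTerm_succ 0 n
    simp only [qBinomTerm]
    linear_combination X ^ (2 * N * (n + 1)) * this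
  have := congrArg tsum (funext key)
  rw [s0'.tsum_sub s1', (s0.mul_left _).tsum_add (s1.mul_left _), s0.tsum_mul_left,
    s1.tsum_mul_left] at this
  simp only [qBinomTerm, mul_zero, pow_zero, psiPosTerm_zero, one_mul] at h0 h1 this ⊢
  linear_combination this + h0 - h1

theorem X_pow_dvd_tsum_qBinomTerm_sub_one (N : ℕ) :
    X ^ N ∣ ∑' n, qBinomTerm N n - 1 := by
  have s0 := summable_qBinomTerm N
  have h0 := s0.tsum_eq_zero_add
  rw [show qBinomTerm N 0 = 1 by simp [qBinomTerm, psiPosTerm_zero]] at h0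
  rw [h0, add_sub_cancel_left]
  refine X_pow_dvd_tsum ((summable_nat_add_iff 1).mpr s0) fun n ↦ Dvd.dvd.mul_right ?_ _
  exact pow_dvd_pow X (by nlinarith)

/-- The `q`-binomial theorem at `z = q`: here `b = q²`, and the bilateral series has no terms of
negative index. -/
theorem psiSum_zero_mul : qPochInf X (X ^ 2) * psiSum 0 = qPochInf (-X ^ 2) (X ^ 2) := by
  have hX : (X : ℤ⟦X⟧) ∣ X ^ 2 := dvd_pow_self X two_ne_zero
  have hneg : ∀ k, psiNegTerm 0 (k + 1) = 0 := fun k ↦ by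
    simp [psiNegTerm, Finset.prod_range_succ']
  have h0 : psiSum 0 = ∑' n, qBinomTerm 0 n := by
    simp [psiSum, hneg, qBinomTerm]
  have hN (N : ℕ) : qPoch X (X ^ 2) N * psiSum 0 =
      qPoch (-X ^ 2) (X ^ 2) N * ∑' n, qBinomTerm N n := by
    induction N with
    | zero => simp [qPoch_zero, h0]
    | succ N ih =>
      rw [qPoch_succ, qPoch_succ]
      linear_combination (1 - X ^ (2 * N + 1)) * ih +
        qPoch (-X ^ 2) (X ^ 2) N * tsum_qBinomTerm_succ N
  have := (tendsto_qPoch (-X ^ 2) hX).mul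
    (tendsto_of_X_pow_dvd X_pow_dvd_tsum_qBinomTerm_sub_one)
  rw [mul_one] at this
  refine tendsto_nhds_unique ((tendsto_qPoch X hX).mul_const (psiSum 0)) (this.congr fun N ↦ ?_)
  exact (hN N).symm

/-! ### The even part of the mock theta function -/

theorem psiPosTerm_one (n : ℕ) : psiPosTerm 1 n = (1 - X) * mockBTerm n := by
  have h1 := psiPosTerm_mul 1 n
  have h2 := mockBTerm_mul n
  rw [qPoch_succ'] at h2
  have h3 : (X ^ (1 + 2) : ℤ⟦X⟧) = X * X ^ 2 := by ring
  rw [h3] at h1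
  refine mul_right_cancel₀ (qPoch_ne_zero (a := X * X ^ 2) (by simp) (X ^ 2) n) ?_
  linear_combination h1 - h2

theorem psiNegTerm_one_succ (k : ℕ) :
    psiNegTerm 1 (k + 1) = (1 - X) * rescale (-1 : ℤ) (mockBTerm k) := by
  have h1 := congrArg (rescale (-1 : ℤ)) (mockBTerm_mul k)
  simp only [map_mul, map_pow, map_qPoch, map_neg, rescale_neg_one_X, neg_neg, neg_sq] at h1
  have h2 : psiNegTerm 1 (k + 1) * qPoch (-X) (X ^ 2) (k + 1) =
      (1 - X) * ((-X) ^ k * qPoch X (X ^ 2) k) := by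
    clear h1
    induction k with
    | zero =>
      have := psiNegTerm_succ 1 0
      simp only [psiNegTerm_zero] at this
      simp only [qPoch_succ, qPoch_zero]
      linear_combination this
    | succ k ih =>
      rw [qPoch_succ, qPoch_succ X]
      linear_combination qPoch (-X) (X ^ 2) (k + 1) * psiNegTerm_succ 1 (k + 1) +
        (X ^ (2 * (k + 1)) - X) * ih
  refine mul_right_cancel₀ (qPoch_ne_zero (a := -X) (by simp) (X ^ 2) (k + 1)) ?_
  linear_combination h2 - (1 - X) * h1

theorem continuous_rescale_neg_one : Continuous (rescale (-1 : ℤ) : ℤ⟦X⟧ → ℤ⟦X⟧) := by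
  rw [continuous_iff_continuousAt]
  intro f
  rw [ContinuousAt, WithPiTopology.tendsto_iff_coeff_tendsto]
  intro d
  simp only [coeff_rescale]
  exact ((WithPiTopology.continuous_coeff ℤ d).tendsto f).const_mul _

/-- Reversing the bilateral series at `b = q³` exchanges `q` and `-q`, so its two halves are
`B(q)` and `B(-q)`. -/
theorem psiSum_one : psiSum 1 = (1 - X) * (mockB + rescale (-1 : ℤ) mockB) := by
  have h1 := hasSum_mockB
  have h2 := h1.map (rescale (-1 : ℤ)) continuous_rescale_neg_one
  rw [psiSum, mul_add]
  congr 1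
  · simp_rw [psiPosTerm_one]
    exact (h1.mul_left _).tsum_eq
  · simp_rw [psiNegTerm_one_succ]
    exact (h2.mul_left _).tsum_eq

/-- The even part `∑ b(2n) q^n` of the mock theta function. -/
noncomputable def mockBEven : ℤ⟦X⟧ := PowerSeries.mk fun n ↦ mockBCoeff (2 * n)

theorem mockB_add_rescale :
    mockB + rescale (-1 : ℤ) mockB = 2 * expand 2 two_ne_zero mockBEven := by
  ext n
  rw [two_mul, map_add, map_add, coeff_rescale, coeff_expand]
  split_ifs with h
  · obtain ⟨m, rfl⟩ := h
    simp [mockB, mockBEven]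
  · rw [(Nat.not_even_iff_odd.mp (mt Even.two_dvd h)).neg_one_pow]
    ring

theorem expand_injective {p : ℕ} (hp : p ≠ 0) :
    Function.Injective (expand p hp : ℤ⟦X⟧ → ℤ⟦X⟧) := fun f g h ↦ by
  ext n
  simpa using congrArg (coeff (p * n)) h

/-- The even part of the mock theta function is an infinite product:
`∑ b(2n) q^n = (-q; q)_∞³ (q; q)_∞ / (q; q²)_∞²`. -/
theorem mockBEven_mul :
    mockBEven * qPochInf X (X ^ 2) ^ 2 = qPochInf (-X) X ^ 3 * qPochInf X X := by
  have hX : (X : ℤ⟦X⟧) ∣ X ^ 2 := dvd_pow_self X two_ne_zero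
  have h1 := psiSum_one_mul
  have h2 := psiSum_zero_mul
  have h3 := qPochInf_eq_mul (-1 : ℤ⟦X⟧) hX
  have h4 := qPochInf_eq_mul (X : ℤ⟦X⟧) hX
  have h5 := qPochInf_mul_neg (X : ℤ⟦X⟧) hX
  rw [neg_one_mul] at h3
  rw [← pow_succ'] at h4
  have e1 := expand_qPochInf two_ne_zero (X : ℤ⟦X⟧) hX
  have e2 := expand_qPochInf two_ne_zero (-X : ℤ⟦X⟧) (t := X) dvd_rfl
  have e3 := expand_qPochInf two_ne_zero (X : ℤ⟦X⟧) (t := X) dvd_rfl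
  simp only [map_pow, map_neg, expand_X] at e1 e2 e3
  rw [← e1] at h5
  rw [psiSum_one, mockB_add_rescale, h3, ← e2, ← e3] at h1
  rw [← e2] at h2
  refine expand_injective two_ne_zero (mul_left_cancel₀ (a := (2 : ℤ⟦X⟧))
    (fun h ↦ by simpa [← one_add_one_eq_two] using congrArg constantCoeff h) ?_)
  simp only [map_mul, map_pow]
  rw [← h5]
  linear_combination qPochInf X (X ^ 2) * h1 +
    2 * (expand 2 two_ne_zero (qPochInf (-X) X)) ^ 2 * expand 2 two_ne_zero (qPochInf X X) * h2 +
    2 * qPochInf X (X ^ 2) * qPochInf (-X) (X ^ 2) ^ 2 * expand 2 two_ne_zero mockBEven * h4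

/-! ### Theta series of squares and triangular numbers -/

section FiniteForms

variable {R : Type*} [CommRing R]

/-- Multiplied by `∏ (1 + q^k)`, the partial sums of `1 + 2 ∑ (-1)^s q^(s²)` are, up to terms of
high order, the partial products of `∏ (1 - q^k)` (Shanks). -/
theorem shanks_square (q : R) (n : ℕ) :
    (∏ k ∈ Finset.range n, (1 + q ^ (k + 1))) *
        (1 + 2 * ∑ s ∈ Finset.range n, (-1) ^ (s + 1) * q ^ ((s + 1) ^ 2)) =
      ∏ k ∈ Finset.Ico 0 n, (1 - q ^ (k + 1)) +
        ∑ s ∈ Finset.range n, q ^ ((s + 1) * (n + 1)) * (2 * (-1) ^ (s + 1) *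
          (∏ k ∈ Finset.Ico (s + 1) n, (1 - q ^ (k + 1))) *
            ∏ k ∈ Finset.range s, (1 + q ^ (k + 1))) := by
  induction n with
  | zero => simp
  | succ n ih =>
    -- passing from `n` to `n + 1` changes the sum on the right by a telescoping sum
    have tele : ∀ m ≤ n, ∑ s ∈ Finset.range m, (q ^ (s + 1) * (1 - q ^ (n + 1)) -
        (1 + q ^ (n + 1))) * (q ^ ((s + 1) * (n + 1)) * (2 * (-1) ^ (s + 1) *
          (∏ k ∈ Finset.Ico (s + 1) n, (1 - q ^ (k + 1))) *
            ∏ k ∈ Finset.range s, (1 + q ^ (k + 1)))) =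
        2 * (q ^ (n + 1) * ∏ k ∈ Finset.Ico 0 n, (1 - q ^ (k + 1))) -
          2 * ((-1) ^ m * q ^ ((m + 1) * (n + 1)) * (∏ k ∈ Finset.Ico m n, (1 - q ^ (k + 1))) *
            ∏ k ∈ Finset.range m, (1 + q ^ (k + 1))) := by
      intro m hm
      induction m with
      | zero => simp
      | succ m ihm =>
        rw [Finset.sum_range_succ, ihm (by omega), Finset.prod_range_succ _ m,
          Finset.prod_eq_prod_Ico_succ_bot (show m < n by omega)]
        ring
    have hstep : ∀ s ∈ Finset.range n, q ^ ((s + 1) * (n + 1 + 1)) * (2 * (-1) ^ (s + 1) *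
          (∏ k ∈ Finset.Ico (s + 1) (n + 1), (1 - q ^ (k + 1))) *
            ∏ k ∈ Finset.range s, (1 + q ^ (k + 1))) =
        (q ^ (s + 1) * (1 - q ^ (n + 1)) - (1 + q ^ (n + 1))) *
          (q ^ ((s + 1) * (n + 1)) * (2 * (-1) ^ (s + 1) *
          (∏ k ∈ Finset.Ico (s + 1) n, (1 - q ^ (k + 1))) *
            ∏ k ∈ Finset.range s, (1 + q ^ (k + 1)))) +
        (1 + q ^ (n + 1)) * (q ^ ((s + 1) * (n + 1)) * (2 * (-1) ^ (s + 1) *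
          (∏ k ∈ Finset.Ico (s + 1) n, (1 - q ^ (k + 1))) *
            ∏ k ∈ Finset.range s, (1 + q ^ (k + 1)))) := by
      intro s hs
      rw [Finset.prod_Ico_succ_top (by have := Finset.mem_range.mp hs; omega)]
      ring
    rw [Finset.sum_range_succ _ n, Finset.sum_range_succ _ n, Finset.sum_congr rfl hstep,
      Finset.sum_add_distrib, tele n le_rfl, ← Finset.mul_sum,
      Finset.prod_range_succ, Finset.prod_Ico_succ_top (Nat.zero_le n)]
    simp only [Finset.Ico_self, Finset.prod_empty]
    linear_combination (1 + q ^ (n + 1)) * ih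

/-- Multiplied by `∏ (1 - q^(2k-1))`, the partial sums of `∑ q^(s(s+1)/2)` are, up to terms of
high order, the partial products of `∏ (1 - q^(2k))` (Shanks). -/
theorem shanks_triangular (q : R) (n : ℕ) :
    (∏ k ∈ Finset.range n, (1 - q ^ (2 * k + 1))) *
        ∑ s ∈ Finset.range (2 * n), q ^ (s * (s + 1) / 2) =
      ∑ s ∈ Finset.range n, q ^ (s * (2 * n + 1)) *
        ((∏ k ∈ Finset.Ico s n, (1 - q ^ (2 * k + 2))) *
          ∏ k ∈ Finset.range s, (1 - q ^ (2 * k + 1))) := by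
  induction n with
  | zero => simp
  | succ n ih =>
    -- passing from `n` to `n + 1` changes the sum on the right by a telescoping sum
    have tele : ∀ m ≤ n, ∑ s ∈ Finset.range m, (q ^ (2 * s) * (1 - q ^ (2 * n + 2)) -
        (1 - q ^ (2 * n + 1))) * (q ^ (s * (2 * n + 1)) *
        ((∏ k ∈ Finset.Ico s n, (1 - q ^ (2 * k + 2))) *
          ∏ k ∈ Finset.range s, (1 - q ^ (2 * k + 1)))) =
        (1 - q ^ (2 * m)) * (q ^ (m * (2 * n + 1)) *
        ((∏ k ∈ Finset.Ico m n, (1 - q ^ (2 * k + 2))) *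
          ∏ k ∈ Finset.range m, (1 - q ^ (2 * k + 1)))) := by
      intro m hm
      induction m with
      | zero => simp
      | succ m ihm =>
        rw [Finset.sum_range_succ, ihm (by omega), Finset.prod_range_succ _ m,
          Finset.prod_eq_prod_Ico_succ_bot (show m < n by omega)]
        ring
    have hstep : ∀ s ∈ Finset.range n, q ^ (s * (2 * (n + 1) + 1)) *
        ((∏ k ∈ Finset.Ico s (n + 1), (1 - q ^ (2 * k + 2))) *
          ∏ k ∈ Finset.range s, (1 - q ^ (2 * k + 1))) =
        (q ^ (2 * s) * (1 - q ^ (2 * n + 2)) -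
        (1 - q ^ (2 * n + 1))) * (q ^ (s * (2 * n + 1)) *
        ((∏ k ∈ Finset.Ico s n, (1 - q ^ (2 * k + 2))) *
          ∏ k ∈ Finset.range s, (1 - q ^ (2 * k + 1)))) +
        (1 - q ^ (2 * n + 1)) * (q ^ (s * (2 * n + 1)) *
        ((∏ k ∈ Finset.Ico s n, (1 - q ^ (2 * k + 2))) *
          ∏ k ∈ Finset.range s, (1 - q ^ (2 * k + 1)))) := by
      intro s hs
      rw [Finset.prod_Ico_succ_top (by have := Finset.mem_range.mp hs; omega)]
      ring
    have e1 : 2 * n * (2 * n + 1) / 2 = n * (2 * n + 1) := by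
      rw [mul_assoc, Nat.mul_div_cancel_left _ two_pos]
    have e2 : (2 * n + 1) * (2 * n + 1 + 1) / 2 = n * (2 * n + 1) + (2 * n + 1) := by
      rw [show (2 * n + 1) * (2 * n + 1 + 1) = 2 * (n * (2 * n + 1) + (2 * n + 1)) by ring,
        Nat.mul_div_cancel_left _ two_pos]
    rw [show 2 * (n + 1) = 2 * n + 1 + 1 by ring, Finset.sum_range_succ _ (2 * n + 1),
      Finset.sum_range_succ _ (2 * n), e1, e2, ← show 2 * (n + 1) = 2 * n + 1 + 1 by ring,
      Finset.sum_range_succ _ n, Finset.sum_congr rfl hstep,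
      Finset.sum_add_distrib, tele n le_rfl, ← Finset.mul_sum,
      Finset.prod_range_succ, Finset.prod_Ico_succ_top le_rfl]
    simp only [Finset.Ico_self, Finset.prod_empty]
    linear_combination (1 - q ^ (2 * n + 1)) * ih

end FiniteForms

theorem coeff_tsum_eq_zero {f : ℕ → ℤ⟦X⟧} (hf : Summable f) {d : ℕ}
    (h : ∀ n, coeff d (f n) = 0) : coeff d (∑' n, f n) = 0 := by
  have := (WithPiTopology.hasSum_iff_hasSum_coeff ℤ).mp hf.hasSum d
  simp only [h] at this
  exact this.unique hasSum_zero

/-- The nonconstant half `∑_{s ≥ 1} (-1)^s q^(s²)` of the theta series of the squares. -/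
noncomputable def thetaHalf : ℤ⟦X⟧ := ∑' s : ℕ, (-1) ^ (s + 1) * X ^ ((s + 1) ^ 2)

/-- The theta series `∑_{s ∈ ℤ} (-1)^s q^(s²)` of the squares, Ramanujan's `φ(-q)`. -/
noncomputable def thetaSquare : ℤ⟦X⟧ := 1 + 2 * thetaHalf

/-- The theta series `∑_{s ≥ 0} q^(s(s+1)/2)` of the triangular numbers, Ramanujan's `ψ(q)`. -/
noncomputable def thetaTri : ℤ⟦X⟧ := ∑' s : ℕ, X ^ (s * (s + 1) / 2)

theorem le_triangular (s : ℕ) : s ≤ s * (s + 1) / 2 := by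
  rw [Nat.le_div_iff_mul_le two_pos]
  rcases s with _ | s <;> nlinarith

theorem summable_thetaHalf : Summable fun s : ℕ ↦ (-1 : ℤ⟦X⟧) ^ (s + 1) * X ^ ((s + 1) ^ 2) :=
  summable_of_X_pow_dvd fun s ↦ (pow_dvd_pow X (by nlinarith)).mul_left _

theorem summable_thetaTri : Summable fun s : ℕ ↦ (X : ℤ⟦X⟧) ^ (s * (s + 1) / 2) :=
  summable_of_X_pow_dvd fun s ↦ pow_dvd_pow X (le_triangular s)

theorem coeff_thetaSquare_eq_zero {d : ℕ} (hd : ¬ IsSquare d) : coeff d thetaSquare = 0 := by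
  have h0 : d ≠ 0 := fun h ↦ hd (h ▸ ⟨0, rfl⟩)
  have h : coeff d thetaHalf = 0 := by
    refine coeff_tsum_eq_zero summable_thetaHalf fun s ↦ ?_
    rw [show (-1 : ℤ⟦X⟧) = C (-1) by simp, ← map_pow, coeff_C_mul, coeff_X_pow, if_neg, mul_zero]
    exact fun h ↦ hd ⟨s + 1, by rw [h, pow_two]⟩
  rw [thetaSquare, two_mul, map_add, map_add, h, coeff_one, if_neg h0]
  rfl

theorem coeff_thetaTri_eq_zero {d : ℕ} (hd : ∀ s, 2 * d ≠ s * (s + 1)) :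
    coeff d thetaTri = 0 := by
  refine coeff_tsum_eq_zero summable_thetaTri fun s ↦ ?_
  rw [coeff_X_pow, if_neg]
  exact fun h ↦ hd s (by rw [h, Nat.mul_div_cancel' (Nat.even_mul_succ_self s).two_dvd])

/-- Gauss: `∑ (-1)^s q^(s²) = (q; q)_∞ / (-q; q)_∞`. -/
theorem thetaSquare_mul : thetaSquare * qPochInf (-X) X = qPochInf X X := by
  have t1 := tendsto_qPoch (-X : ℤ⟦X⟧) (dvd_refl X)
  have t2 := tendsto_qPoch (X : ℤ⟦X⟧) (dvd_refl X)
  have t3 := ((summable_thetaHalf.hasSum.tendsto_sum_nat).const_mul 2).const_add 1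
  have t4 := (t3.mul t1).sub t2
  refine sub_eq_zero.mp (tendsto_nhds_unique t4 (tendsto_of_X_pow_dvd fun n ↦ ?_))
  have h := shanks_square (X : ℤ⟦X⟧) n
  have e1 : ∏ k ∈ Finset.range n, (1 + X ^ (k + 1) : ℤ⟦X⟧) = qPoch (-X) X n :=
    Finset.prod_congr rfl fun k _ ↦ by ring
  have e2 : ∏ k ∈ Finset.Ico 0 n, (1 - X ^ (k + 1) : ℤ⟦X⟧) = qPoch X X n := by
    rw [← Finset.range_eq_Ico]
    exact Finset.prod_congr rfl fun k _ ↦ by ring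
  rw [e1, e2, mul_comm] at h
  rw [h, sub_zero, add_sub_cancel_left]
  exact Finset.dvd_sum fun s _ ↦ (pow_dvd_pow X (by nlinarith)).mul_right _

/-- Gauss: `∑ q^(s(s+1)/2) = (q²; q²)_∞ / (q; q²)_∞`. -/
theorem thetaTri_mul : thetaTri * qPochInf X (X ^ 2) = qPochInf (X ^ 2) (X ^ 2) := by
  have hX : (X : ℤ⟦X⟧) ∣ X ^ 2 := dvd_pow_self X two_ne_zero
  have t1 := tendsto_qPoch (X : ℤ⟦X⟧) hX
  have t2 := tendsto_qPoch (X ^ 2 : ℤ⟦X⟧) hX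
  have t3 := (summable_thetaTri.hasSum.tendsto_sum_nat).comp
    (tendsto_id.const_mul_atTop' (two_pos : 0 < 2))
  have t4 := (t3.mul t1).sub t2
  refine sub_eq_zero.mp (tendsto_nhds_unique (t4.comp (tendsto_add_atTop_nat 1))
    (tendsto_of_X_pow_dvd fun n ↦ ?_))
  have h := shanks_triangular (X : ℤ⟦X⟧) (n + 1)
  have e1 : ∏ k ∈ Finset.range (n + 1), (1 - X ^ (2 * k + 1) : ℤ⟦X⟧) = qPoch X (X ^ 2) (n + 1) :=
    Finset.prod_congr rfl fun k _ ↦ by ring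
  have e2 : ∏ k ∈ Finset.Ico 0 (n + 1), (1 - X ^ (2 * k + 2) : ℤ⟦X⟧) =
      qPoch (X ^ 2) (X ^ 2) (n + 1) := by
    rw [← Finset.range_eq_Ico]
    exact Finset.prod_congr rfl fun k _ ↦ by ring
  rw [e1, mul_comm, Finset.sum_range_succ', e2] at h
  simp only [Function.comp, id]
  rw [h]
  simp only [zero_mul, pow_zero, Finset.range_zero, Finset.prod_empty, one_mul, mul_one,
    sub_zero, add_sub_cancel_right]
  exact Finset.dvd_sum fun s _ ↦ (pow_dvd_pow X (by nlinarith)).mul_right _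

/-! ### Congruences modulo 4 and 9 -/

theorem qPochInf_mul_neg_X :
    qPochInf X X * qPochInf (-X) X = qPochInf (X ^ 2 : ℤ⟦X⟧) (X ^ 2) :=
  qPochInf_mul_neg X dvd_rfl

/-- `ψ(q) = φ(-q) (-q; q)_∞³`. -/
theorem thetaTri_eq : thetaTri = thetaSquare * qPochInf (-X) X ^ 3 := by
  linear_combination (qPochInf (-X) X) * thetaTri_mul - thetaTri * qPochInf_odd_mul_distinct -
    qPochInf (-X) X ^ 2 * thetaSquare_mul - qPochInf (-X) X * qPochInf_mul_neg_X

theorem mockBEven_eq : mockBEven = qPochInf (-X) X ^ 5 * qPochInf X X := by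
  linear_combination (qPochInf (-X) X) ^ 2 * mockBEven_mul -
    mockBEven * (1 + qPochInf X (X ^ 2) * qPochInf (-X) X) * qPochInf_odd_mul_distinct

/-- `∑ b(2n) q^n = ψ(q)² / φ(-q)`. -/
theorem mockBEven_mul_thetaSquare : mockBEven * thetaSquare = thetaTri ^ 2 := by
  rw [mockBEven_eq, thetaTri_eq]
  linear_combination -(qPochInf (-X) X ^ 5 * thetaSquare) * thetaSquare_mul

/-- `∑ b(2n) q^n · φ(-q)² = φ(-q²)² ψ(q²)`. -/
theorem mockBEven_mul_thetaSquare_sq :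
    mockBEven * thetaSquare ^ 2 = expand 2 two_ne_zero (thetaSquare ^ 2 * thetaTri) := by
  have e := expand_qPochInf two_ne_zero (X : ℤ⟦X⟧) (t := X) dvd_rfl
  rw [expand_X, ← qPochInf_mul_neg_X, ← thetaSquare_mul] at e
  have h : thetaSquare ^ 2 * thetaTri = (thetaSquare * qPochInf (-X) X) ^ 3 := by
    rw [thetaTri_eq]; ring
  rw [h, map_pow, e, mockBEven_eq, ← thetaSquare_mul]
  ring

theorem coeff_natCast_mul (c n : ℕ) (f : ℤ⟦X⟧) : coeff n ((c : ℤ⟦X⟧) * f) = c * coeff n f := by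
  rw [show (c : ℤ⟦X⟧) = C (c : ℤ) by simp, coeff_C_mul]

/-- Modulo `4` the square of `φ(-q)` is `1`, so `∑ b(2n) q^n ≡ ψ(q²)`. -/
theorem four_dvd_mockBCoeff {j : ℕ} (hj : ¬ IsSquare (4 * j + 1)) : 4 ∣ mockBCoeff (2 * j) := by
  have h1 := mockBEven_mul_thetaSquare_sq
  have h2 : mockBEven = expand 2 two_ne_zero thetaTri + ((4 : ℕ) : ℤ⟦X⟧) *
      (expand 2 two_ne_zero (thetaHalf + thetaHalf ^ 2) * expand 2 two_ne_zero thetaTri -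
        mockBEven * (thetaHalf + thetaHalf ^ 2)) := by
    have h3 : thetaSquare ^ 2 = 1 + 4 * (thetaHalf + thetaHalf ^ 2) := by
      rw [thetaSquare]; ring
    rw [h3] at h1
    simp only [map_mul, map_add, map_one, map_ofNat] at h1 ⊢
    push_cast
    linear_combination h1
  have h3 : coeff j (expand 2 two_ne_zero thetaTri) = 0 := by
    rw [coeff_expand]
    split_ifs with hd
    · obtain ⟨i, rfl⟩ := hd
      rw [Nat.mul_div_cancel_left _ two_pos]
      refine coeff_thetaTri_eq_zero fun s hs ↦ hj ⟨2 * s + 1, ?_⟩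
      rw [hs]; ring
    · rfl
  have h4 : mockBCoeff (2 * j) = coeff j mockBEven := by simp [mockBEven]
  rw [h4, h2, map_add, h3, zero_add, coeff_natCast_mul]
  exact dvd_mul_right _ _

/-- Multiplying by a power series in `q³` preserves the vanishing of the coefficients whose index
is `2` modulo `3`. -/
theorem coeff_mul_expand_three {f : ℤ⟦X⟧} (hf : ∀ d, d % 3 = 2 → coeff d f = 0) (g : ℤ⟦X⟧)
    {d : ℕ} (hd : d % 3 = 2) : coeff d (f * expand 3 three_ne_zero g) = 0 := by
  rw [coeff_mul]
  refine Finset.sum_eq_zero fun x hx ↦ ?_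
  rw [Finset.HasAntidiagonal.mem_antidiagonal] at hx
  by_cases h : 3 ∣ x.2
  · rw [hf x.1 (by omega), zero_mul]
  · rw [coeff_expand_of_not_dvd _ _ _ h, mul_zero]

/-- The Frobenius congruence `f(q)³ ≡ f(q³)` modulo `3`. -/
theorem exists_cube_eq_expand_add (f : ℤ⟦X⟧) :
    ∃ r, f ^ 3 = expand 3 three_ne_zero f + ((3 : ℕ) : ℤ⟦X⟧) * r := by
  have h : PowerSeries.map (Int.castRingHom (ZMod 3)) (f ^ 3 - expand 3 three_ne_zero f) = 0 := by
    have := MvPowerSeries.map_frobenius_expand (σ := Unit) 3 three_ne_zero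
      (f := PowerSeries.map (Int.castRingHom (ZMod 3)) f)
    rw [ZMod.frobenius_zmod, MvPowerSeries.map_id] at this
    rw [map_sub, map_pow, map_expand, sub_eq_zero]
    exact this.symm
  have h3 (n : ℕ) : (3 : ℤ) ∣ coeff n (f ^ 3 - expand 3 three_ne_zero f) := by
    have := congrArg (coeff n) h
    rw [coeff_map, map_zero] at this
    exact (ZMod.intCast_zmod_eq_zero_iff_dvd _ 3).mp this
  choose r hr using h3
  refine ⟨PowerSeries.mk r, ?_⟩
  ext n
  have := hr n
  rw [map_sub] at this
  rw [map_add, coeff_natCast_mul, coeff_mk]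
  push_cast
  linarith

theorem coeff_thetaSquare_of_mod_three {d : ℕ} (hd : d % 3 = 2) : coeff d thetaSquare = 0 := by
  refine coeff_thetaSquare_eq_zero fun ⟨s, hs⟩ ↦ ?_
  have h : s % 3 = 0 ∨ s % 3 = 1 ∨ s % 3 = 2 := by omega
  rcases h with h | h | h <;> simp [hs, Nat.mul_mod, h] at hd

theorem coeff_thetaTri_of_mod_three {d : ℕ} (hd : d % 3 = 2) : coeff d thetaTri = 0 := by
  refine coeff_thetaTri_eq_zero fun s hs ↦ ?_
  have h2 : 2 * d % 3 = 1 := by omega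
  have h : s % 3 = 0 ∨ s % 3 = 1 ∨ s % 3 = 2 := by omega
  rcases h with h | h | h <;> simp [hs, Nat.mul_mod, Nat.add_mod, h] at h2

/-- Write `ψ(q) = φ(-q) K + 3 r` with `K` a power series in `q³`. Then `ψ(q)² / φ(-q)` is
`φ(-q) K² + 6 K r` modulo `9`, and neither `φ(-q)` nor `r` has exponents that are `2`
modulo `3`. -/
theorem nine_dvd_mockBCoeff {j : ℕ} (hj : j % 3 = 2) : 9 ∣ mockBCoeff (2 * j) := by
  obtain ⟨r', hr'⟩ := exists_cube_eq_expand_add (qPochInf (-X) X)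
  set D := qPochInf (-X : ℤ⟦X⟧) X
  set K := expand 3 three_ne_zero D with hK
  obtain ⟨r, hr⟩ : ∃ r, r = thetaSquare * r' := ⟨_, rfl⟩
  have hpsi : thetaTri = thetaSquare * K + ((3 : ℕ) : ℤ⟦X⟧) * r := by
    rw [thetaTri_eq, hr', hr]; ring
  have hr0 : ∀ d, d % 3 = 2 → coeff d r = 0 := fun d hd ↦ by
    have := congrArg (coeff d) hpsi
    rw [map_add, coeff_natCast_mul, coeff_thetaTri_of_mod_three hd,
      coeff_mul_expand_three (fun _ ↦ coeff_thetaSquare_of_mod_three) _ hd] at this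
    push_cast at this
    linarith
  have hc : constantCoeff thetaSquare = 1 := by
    have := congrArg constantCoeff thetaSquare_mul
    rwa [map_mul, constantCoeff_qPochInf (by simp) dvd_rfl,
      constantCoeff_qPochInf (by simp) dvd_rfl, mul_one] at this
  have hi := mul_invOfUnit thetaSquare 1 hc
  have hG : mockBEven = thetaSquare * expand 3 three_ne_zero (D ^ 2) +
      ((6 : ℕ) : ℤ⟦X⟧) * (r * expand 3 three_ne_zero D) +
      ((9 : ℕ) : ℤ⟦X⟧) * (r ^ 2 * invOfUnit thetaSquare 1) := by
    have h := mockBEven_mul_thetaSquare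
    rw [hpsi] at h
    rw [map_pow, ← hK]
    push_cast at h ⊢
    linear_combination invOfUnit thetaSquare 1 * h +
      (thetaSquare * K ^ 2 + 6 * r * K - mockBEven) * hi
  have h4 : mockBCoeff (2 * j) = coeff j mockBEven := by simp [mockBEven]
  rw [h4, hG, map_add, map_add, coeff_natCast_mul, coeff_natCast_mul,
    coeff_mul_expand_three (fun _ ↦ coeff_thetaSquare_of_mod_three) _ hj,
    coeff_mul_expand_three hr0 _ hj, mul_zero, zero_add, zero_add]
  exact dvd_mul_right _ _

/-- `b(6i+4)` is divisible by `36` unless `2(6i+4)+1` is a perfect square. -/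
theorem thirtySix_dvd_mockBCoeff {i : ℕ} (hi : ¬ IsSquare (12 * i + 9)) :
    36 ∣ mockBCoeff (6 * i + 4) := by
  have h9 := nine_dvd_mockBCoeff (j := 3 * i + 2) (by omega)
  have h4 := four_dvd_mockBCoeff (j := 3 * i + 2)
    (by rwa [show 4 * (3 * i + 2) + 1 = 12 * i + 9 by ring])
  rw [show 2 * (3 * i + 2) = 6 * i + 4 by ring] at h4 h9
  omega

theorem exists_sq_eq_twelve_mul_add_one {p : ℕ} (hp : p.Prime) (hp5 : 5 ≤ p) (k : ℕ) :
    ∃ t, p ^ (2 * k + 2) = 12 * t + 1 := by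
  have h2 : ¬ 2 ∣ p := fun h ↦ by
    have := (Nat.prime_dvd_prime_iff_eq Nat.prime_two hp).mp h; omega
  have h3 : ¬ 3 ∣ p := fun h ↦ by
    have := (Nat.prime_dvd_prime_iff_eq Nat.prime_three hp).mp h; omega
  have h : p ^ 2 % 12 = 1 := by
    have h12 : p % 12 = 1 ∨ p % 12 = 5 ∨ p % 12 = 7 ∨ p % 12 = 11 := by omega
    rcases h12 with h | h | h | h <;> simp [Nat.pow_mod, h]
  have h' : p ^ (2 * k + 2) % 12 = 1 := by
    rw [show 2 * k + 2 = 2 * (k + 1) by ring, pow_mul, Nat.pow_mod, h, one_pow, Nat.one_mod]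
  exact ⟨p ^ (2 * k + 2) / 12, by omega⟩

theorem corollary3 (p : ℕ) [Fact p.Prime] (hp : 5 ≤ p) (ℓ : ℕ) (hℓ₁ : 1 ≤ ℓ) (hℓ₂ : ℓ ≤ p - 1)
    (hleg : legendreSym p (12 * (ℓ : ℤ) + 9) = -1) (n k : ℕ) :
    mockBCoeff (6 * p ^ (2 * k + 3) * n + (3 * p ^ (2 * k + 2) * (4 * ℓ + 3) - 1) / 2)
      ≡ 0 [ZMOD 36] := by
  have hprime : p.Prime := Fact.out
  obtain ⟨t, ht⟩ := exists_sq_eq_twelve_mul_add_one hprime hp k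
  have harg : 6 * p ^ (2 * k + 3) * n + (3 * p ^ (2 * k + 2) * (4 * ℓ + 3) - 1) / 2 =
      6 * (p ^ (2 * k + 3) * n + 3 * t * (4 * ℓ + 3) + ℓ) + 4 := by
    have h : 3 * p ^ (2 * k + 2) * (4 * ℓ + 3) - 1 =
        2 * (18 * t * (4 * ℓ + 3) + 6 * ℓ + 4) := by
      rw [ht]
      exact Nat.sub_eq_of_eq_add (by ring)
    rw [h, Nat.mul_div_cancel_left _ two_pos]
    ring
  rw [harg, Int.modEq_zero_iff_dvd]
  refine thirtySix_dvd_mockBCoeff fun ⟨s, hs⟩ ↦ ?_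
  have hs' : (p ^ (k + 1)) ^ 2 * (12 * (p * n) + 12 * ℓ + 9) = s ^ 2 := by
    have hodd : p ^ (2 * k + 3) = p ^ (2 * k + 2) * p := pow_succ _ _
    rw [← pow_mul, show (k + 1) * 2 = 2 * k + 2 by ring, pow_two, ← hs, hodd, ht]
    ring
  obtain ⟨c, rfl⟩ := (Nat.pow_dvd_pow_iff two_ne_zero).mp (Dvd.intro _ hs')
  rw [mul_pow] at hs'
  have hc := Nat.eq_of_mul_eq_mul_left (by have := hprime.pos; positivity) hs'
  -- `12 p n + 12 ℓ + 9 = c²` makes `12 ℓ + 9` a square modulo `p`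
  refine (legendreSym.eq_neg_one_iff p).mp hleg ⟨(c : ZMod p), ?_⟩
  have := congrArg (Nat.cast : ℕ → ZMod p) hc
  push_cast at this ⊢
  rw [CharP.cast_eq_zero] at this
  linear_combination this
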